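/- For $\nu\in\mathbb C$ and $x>0$ let $K_\nu(x)=\frac{\pi}{2\sin(\nu\pi)}\bigl(I_{-\nu}(x)-I_\nu(x)\bigr)$ be the Macdonald function (for $\nu\in\mathbb Z$ the right-hand side is understood as its limit), where $I_\nu(x)=\sum_{m\ge0}\frac{(x/2)^{2m+\nu}}{m!\,\Gamma(m+\nu+1)}$. For $g:(0,\infty)\to\mathbb C$ and $s\in\mathbb C$ let $$\mathfrak K g(s)=\int_0^\infty K_{is}(x)\,g(x)\,\frac{dx}{x}$$ be the Kontorovich–Lebedev transform, and put $$Qg(x)=\Bigl(\frac{d}{dx}-\frac1x\Bigr)g(x),\qquad \mathcal M f(s)=\frac12\bigl(f(s+i)+f(s-i)\bigr).$$ Proposition. The Kontorovich–Lebedev transform sends $Q$ to $\mathcal M$. Precisely, let $g$ be differentiable on $(0,\infty)$ and such that the integral $\mathfrak K g(s)$ converges absolutely for all $s\in\mathbb C$ with $|\operatorname{Im}s|\le1$ and the integral $\mathfrak K(Qg)(s)$ converges absolutely for all $s\in\mathbb R$ (for example, $g\in C_c^\infty(0,\infty)$). Then $f=\mathfrak K g$ is holomorphic in the strip $|\operatorname{Im}s|<1$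 and continuous on $|\operatorname{Im}s|\le1$, and $$\mathfrak K(Qg)(s)=\mathcal M f(s)=\frac12\bigl(f(s+i)+f(s-i)\bigr)\qquad\text{for all } s\in\mathbb R.$$ -/

import Mathlib

open scoped Nat Topology
open Set MeasureTheory Filter

noncomputable section

namespace KontorovichLebedev

/-- The modified Bessel function of the first kind,
`I_ν(z) = ∑ₘ (z/2)^(2m+ν) / (m! Γ(m+ν+1))`, with the principal branch of the power.
(Mathlib's `Gamma` vanishes at its poles, so that the terms there are `0`, as they should be.) -/
def besselI (ν z : ℂ) : ℂ :=
  ∑' m : ℕ, (z / 2) ^ (2 * (m : ℂ) + ν) / ((m ! : ℂ) * Complex.Gamma ((m : ℂ) + ν + 1))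

/-- The quotient `π / (2 sin(νπ)) * (I_{-ν}(z) - I_ν(z))`, meaningful for `ν` not an integer. -/
def macdonaldQuotient (ν z : ℂ) : ℂ :=
  (Real.pi : ℂ) / (2 * Complex.sin (ν * Real.pi)) * (besselI (-ν) z - besselI ν z)

open Classical in
/-- The Macdonald function `K_ν(z)`: the quotient above if `ν` is not an integer, and its limit
(the value of the entire continuation in `ν`) at the integers. -/
def macdonaldK (ν z : ℂ) : ℂ :=
  if ∃ n : ℤ, ν = n then limUnder (𝓝[≠] ν) (fun μ => macdonaldQuotient μ z)
  else macdonaldQuotient ν z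

/-- The integrand `K_{is}(x) g(x) / x` of the Kontorovich–Lebedev transform. -/
def klIntegrand (g : ℝ → ℂ) (s : ℂ) (x : ℝ) : ℂ :=
  macdonaldK (Complex.I * s) (x : ℂ) * g x / (x : ℂ)

/-- The integral defining the Kontorovich–Lebedev transform of `g` at `s` converges absolutely. -/
def KLConverges (g : ℝ → ℂ) (s : ℂ) : Prop :=
  IntegrableOn (klIntegrand g s) (Ioi 0)

/-- The Kontorovich–Lebedev transform `𝔎 g(s) = ∫₀^∞ K_{is}(x) g(x) dx/x`. -/
def klTransform (g : ℝ → ℂ) (s : ℂ) : ℂ :=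
  ∫ x in Ioi (0 : ℝ), klIntegrand g s x

/-- The differential operator `Q g(x) = (d/dx - 1/x) g(x)` on functions on the half-line. -/
def opQ (g : ℝ → ℂ) (x : ℝ) : ℂ := deriv g x - g x / (x : ℂ)

/-- The difference operator `𝓜 f(s) = (f(s+i) + f(s-i)) / 2`. -/
def opM (f : ℂ → ℂ) (s : ℂ) : ℂ := (f (s + Complex.I) + f (s - Complex.I)) / 2

end KontorovichLebedev

end

/-! Everything rests on K_ν(x) = ½ ∫ exp(νt − x cosh t) dt over the real line. This is entire and
even in ν, and since cosh t is the mean of e^t and e^{−t}, differentiation under the integral gives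
K_ν' = −(K_{ν+1} + K_{ν−1})/2. For ν = is, unit shifts of ν are shifts of s by i, so h = K_{is} g/x
has as derivative the integrand of 𝔎(Qg) minus that of 𝓜f (`hasDerivAt_klIntegrand`), and it remains
to see that ∫ h' = 0. As h and h' are integrable, h vanishes at infinity and has a limit at 0. That
limit is zero: |h| ≤ K_0 |g/x| with K_1 |g/x| integrable, whereas K_1/K_0 = −(log K_0)' is not
integrable at 0 (`eq_zero_of_tendsto_of_integrableOn`). The regularity of f follows from the bound
|K_{is}| ≤ 2 K_1 on the closed strip.

The integral must also be identified with the definition through I_ν (`macdonaldK_eq`). For σ in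
(0,1) both candidates satisfy (x^σ K_σ)' = −x^σ K_{σ−1} and x^σ K_σ → 2^{σ−1} Γ(σ) at 0. Both are
even in the order, so the differences at orders σ and 1 − σ solve a closed linear system with
coefficients integrable at 0, and vanish by a Grönwall argument. The identity theorem in ν does the
rest. -/

namespace KontorovichLebedev

/-! ### Holomorphy of parameter integrals -/

/-- An integral depending holomorphically on a parameter, under a uniform integrable bound,
is holomorphic. -/
theorem differentiableOn_integral_of_dominated {α : Type*} [MeasurableSpace α] {μ : Measure α}
    {F : ℂ → α → ℂ} {bound : α → ℝ} {U : Set ℂ} (hU : IsOpen U)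
    (hmeas : ∀ z ∈ U, AEStronglyMeasurable (F z) μ)
    (hdiff : ∀ᵐ a ∂μ, DifferentiableOn ℂ (fun z => F z a) U)
    (hle : ∀ᵐ a ∂μ, ∀ z ∈ U, ‖F z a‖ ≤ bound a) (hbound : Integrable bound μ) :
    DifferentiableOn ℂ (fun z => ∫ a, F z a ∂μ) U := by
  intro z₀ hz₀
  obtain ⟨r, hr, hball⟩ := Metric.isOpen_iff.1 hU z₀ hz₀
  have hsub : ∀ z ∈ Metric.ball z₀ (r / 2), Metric.closedBall z (r / 4) ⊆ U := by
    intro z hz w hw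
    apply hball
    rw [Metric.mem_ball] at hz ⊢
    rw [Metric.mem_closedBall] at hw
    linarith [dist_triangle w z z₀]
  have hball' : Metric.ball z₀ (r / 2) ⊆ U :=
    (Metric.ball_subset_ball (by linarith)).trans hball
  have hderiv : ∀ᵐ a ∂μ, ∀ z ∈ Metric.ball z₀ (r / 2),
      HasDerivAt (fun z => F z a) (deriv (fun z => F z a) z) z := by
    filter_upwards [hdiff] with a ha z hz
    exact (ha.differentiableAt (hU.mem_nhds (hball' hz))).hasDerivAt
  have hderiv_meas : AEStronglyMeasurable (fun a => deriv (fun z => F z a) z₀) μ := by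
    -- The derivative is measurable in the integration variable as a limit of difference quotients
    -- along a sequence of increments tending to zero.
    have hseq : Tendsto (fun n : ℕ => z₀ + (((r / 2) / ((n : ℝ) + 2) : ℝ) : ℂ)) atTop
        (𝓝[≠] z₀) := by
      refine tendsto_nhdsWithin_iff.2 ⟨?_, Eventually.of_forall fun n => ?_⟩
      · have h1 : Tendsto (fun n : ℕ => (r / 2) / ((n : ℝ) + 2)) atTop (𝓝 0) :=
          tendsto_const_nhds.div_atTop
            (tendsto_atTop_add_const_right _ _ tendsto_natCast_atTop_atTop)
        have h2 := (Complex.continuous_ofReal.tendsto 0).comp h1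
        simpa using h2.const_add z₀
      · have : (0 : ℝ) < (r / 2) / ((n : ℝ) + 2) := by positivity
        have h : (((r / 2) / ((n : ℝ) + 2) : ℝ) : ℂ) ≠ 0 := Complex.ofReal_ne_zero.2 this.ne'
        simpa only [mem_compl_iff, mem_singleton_iff, add_eq_left] using h
    refine aestronglyMeasurable_of_tendsto_ae atTop
      (f := fun n : ℕ => fun a => slope (fun z => F z a) z₀
        (z₀ + (((r / 2) / ((n : ℝ) + 2) : ℝ) : ℂ))) (fun n => ?_) ?_
    · simp only [slope_def_module, smul_eq_mul]
      refine AEStronglyMeasurable.const_mul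
        (f := fun a => F (z₀ + (((r / 2) / ((n : ℝ) + 2) : ℝ) : ℂ)) a - F z₀ a)
        ((hmeas _ (hball ?_)).sub (hmeas _ hz₀)) _
      rw [Metric.mem_ball, dist_eq_norm, add_sub_cancel_left, Complex.norm_real, Real.norm_eq_abs,
        abs_of_pos (by positivity), div_lt_iff₀ (by positivity)]
      nlinarith [(Nat.cast_nonneg n : (0 : ℝ) ≤ n)]
    · filter_upwards [hderiv] with a ha
      exact (hasDerivAt_iff_tendsto_slope.1 (ha z₀ (Metric.mem_ball_self (by positivity)))).comp
        hseq
  -- Cauchy's estimate on circles of radius r/4, which stay inside U.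
  have hderiv_le : ∀ᵐ a ∂μ, ∀ z ∈ Metric.ball z₀ (r / 2),
      ‖deriv (fun z => F z a) z‖ ≤ bound a / (r / 4) := by
    filter_upwards [hdiff, hle] with a ha hb z hz
    refine Complex.norm_deriv_le_of_forall_mem_sphere_norm_le (by positivity) ?_
      fun w hw => hb w (hsub z hz (Metric.sphere_subset_closedBall hw))
    exact (ha.mono (hsub z hz)).diffContOnCl_ball subset_rfl
  have hint : Integrable (F z₀) μ :=
    hbound.mono' (hmeas z₀ hz₀) (hle.mono fun a ha => ha z₀ hz₀)
  exact ((hasDerivAt_integral_of_dominated_loc_of_deriv_le (𝕜 := ℂ)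
    (Metric.ball_mem_nhds z₀ (by positivity))
    (Filter.eventually_of_mem (hU.mem_nhds hz₀) hmeas) hint hderiv_meas hderiv_le
    (hbound.div_const _) hderiv).2).differentiableAt.differentiableWithinAt

/-! ### The integral representation and its recurrences -/

theorem sq_div_four_le_cosh (t : ℝ) : t ^ 2 / 4 ≤ Real.cosh t := by
  have h1 := Real.quadratic_le_exp_of_nonneg (abs_nonneg t)
  rw [← Real.cosh_abs, Real.cosh_eq]
  have h2 := Real.exp_pos (-|t|)
  have h3 := abs_nonneg t
  have h4 := sq_abs t
  linarith

theorem integrable_exp_sub_cosh (σ : ℝ) {x : ℝ} (hx : 0 < x) :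
    Integrable fun t : ℝ => Real.exp (σ * t - x * Real.cosh t) := by
  -- Since cosh t ≥ t²/4, a Gaussian dominates the integrand.
  have hq := (integrable_cexp_quadratic (b := ((x / 4 : ℝ) : ℂ)) (by simpa using hx) σ 0).norm
  refine hq.mono' (by fun_prop) (Eventually.of_forall fun t => ?_)
  rw [Real.norm_eq_abs, Real.abs_exp, Complex.norm_exp]
  apply Real.exp_le_exp.2
  have h : (-((x / 4 : ℝ) : ℂ) * (t : ℂ) ^ 2 + (σ : ℂ) * t + 0).re
      = -(x / 4) * t ^ 2 + σ * t := by
    rw [show -((x / 4 : ℝ) : ℂ) * (t : ℂ) ^ 2 + (σ : ℂ) * t + 0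
      = ((-(x / 4) * t ^ 2 + σ * t : ℝ) : ℂ) by push_cast; ring, Complex.ofReal_re]
  rw [h]
  nlinarith [mul_le_mul_of_nonneg_left (sq_div_four_le_cosh t) hx.le]

/-- The integrand `exp (ν t - x cosh t)` of the integral representation of `K_ν(x)`. -/
noncomputable def besselKIntegrand (ν : ℂ) (x t : ℝ) : ℂ :=
  Complex.exp (ν * t - x * Real.cosh t)

/-- The integral `(1/2) ∫ exp (ν t - x cosh t) dt` over the real line, representing `K_ν(x)`. -/
noncomputable def besselKIntegral (ν : ℂ) (x : ℝ) : ℂ :=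
  (1 / 2) * ∫ t : ℝ, besselKIntegrand ν x t

/-- The real version of `besselKIntegral`. -/
noncomputable def besselKReal (σ x : ℝ) : ℝ :=
  (1 / 2) * ∫ t : ℝ, Real.exp (σ * t - x * Real.cosh t)

theorem norm_besselKIntegrand (ν : ℂ) (x t : ℝ) :
    ‖besselKIntegrand ν x t‖ = Real.exp (ν.re * t - x * Real.cosh t) := by
  rw [besselKIntegrand, Complex.norm_exp]
  simp only [Complex.sub_re, Complex.mul_re, Complex.ofReal_re, Complex.ofReal_im, mul_zero,
    sub_zero]

theorem continuous_besselKIntegrand (ν : ℂ) (x : ℝ) : Continuous (besselKIntegrand ν x) := by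
  unfold besselKIntegrand
  fun_prop

theorem integrable_besselKIntegrand (ν : ℂ) {x : ℝ} (hx : 0 < x) :
    Integrable (besselKIntegrand ν x) :=
  (integrable_exp_sub_cosh ν.re hx).mono' (continuous_besselKIntegrand ν x).aestronglyMeasurable
    (Eventually.of_forall fun t => (norm_besselKIntegrand ν x t).le)

theorem besselKIntegral_ofReal (σ x : ℝ) : besselKIntegral σ x = besselKReal σ x := by
  have : ∀ t : ℝ, besselKIntegrand σ x t = ((Real.exp (σ * t - x * Real.cosh t) : ℝ) : ℂ) := by
    intro t; simp [besselKIntegrand]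
  simp only [besselKIntegral, besselKReal, this]
  rw [integral_complex_ofReal]
  push_cast
  rfl

theorem norm_besselKIntegral_le (ν : ℂ) (x : ℝ) : ‖besselKIntegral ν x‖ ≤ besselKReal ν.re x := by
  rw [besselKIntegral, besselKReal, norm_mul]
  have := norm_integral_le_integral_norm (μ := volume) (besselKIntegrand ν x)
  simp only [norm_besselKIntegrand] at this
  norm_num
  linarith

theorem besselKReal_pos (σ : ℝ) {x : ℝ} (hx : 0 < x) : 0 < besselKReal σ x := by
  have : 0 < ∫ t : ℝ, Real.exp (σ * t - x * Real.cosh t) :=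
    integral_exp_pos (integrable_exp_sub_cosh σ hx)
  rw [besselKReal]
  positivity

theorem besselKIntegral_neg (ν : ℂ) (x : ℝ) : besselKIntegral (-ν) x = besselKIntegral ν x := by
  rw [besselKIntegral, besselKIntegral, ← integral_neg_eq_self]
  simp [besselKIntegrand]

theorem besselKReal_neg (σ x : ℝ) : besselKReal (-σ) x = besselKReal σ x := by
  have := besselKIntegral_neg σ x
  rw [← Complex.ofReal_neg, besselKIntegral_ofReal, besselKIntegral_ofReal] at this
  exact_mod_cast this

/-- For |σ| ≤ 1, e^{σt} ≤ e^t + e^{−t}, and both exponentials contribute K_1 by evenness. This makes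
convergence at s = i control the whole closed strip. -/
theorem besselKReal_le {σ : ℝ} (hσ : |σ| ≤ 1) {x : ℝ} (hx : 0 < x) :
    besselKReal σ x ≤ 2 * besselKReal 1 x := by
  have h2 : 2 * besselKReal 1 x = besselKReal 1 x + besselKReal (-1) x := by
    rw [besselKReal_neg]; ring
  rw [h2, besselKReal, besselKReal, besselKReal, ← mul_add,
    ← integral_add (integrable_exp_sub_cosh _ hx) (integrable_exp_sub_cosh _ hx)]
  refine mul_le_mul_of_nonneg_left (integral_mono (integrable_exp_sub_cosh _ hx)
    ((integrable_exp_sub_cosh _ hx).add (integrable_exp_sub_cosh _ hx)) fun t => ?_) (by norm_num)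
  have hσ' := abs_le.1 hσ
  rcases le_total 0 t with ht | ht
  · refine le_add_of_le_of_nonneg (Real.exp_le_exp.2 ?_) (Real.exp_pos _).le
    nlinarith
  · refine le_add_of_nonneg_of_le (Real.exp_pos _).le (Real.exp_le_exp.2 ?_)
    nlinarith

theorem differentiable_besselKIntegral {x : ℝ} (hx : 0 < x) :
    Differentiable ℂ fun ν => besselKIntegral ν x := by
  intro ν₀
  refine DifferentiableAt.const_mul ?_ _
  set R := ‖ν₀‖ + 1
  have hν₀ : ν₀ ∈ Metric.ball (0 : ℂ) R := by simp [R]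
  refine (differentiableOn_integral_of_dominated (F := fun ν t => besselKIntegrand ν x t)
    (bound := fun t => Real.exp (R * t - x * Real.cosh t)
    + Real.exp (-R * t - x * Real.cosh t)) Metric.isOpen_ball
    (fun z _ => (continuous_besselKIntegrand z x).aestronglyMeasurable)
    (Eventually.of_forall fun t => ?_) (Eventually.of_forall fun t z hz => ?_)
    ((integrable_exp_sub_cosh _ hx).add (integrable_exp_sub_cosh _ hx))).differentiableAt
    (Metric.isOpen_ball.mem_nhds hν₀)
  · unfold besselKIntegrand
    fun_prop
  · rw [norm_besselKIntegrand]
    have hz' := abs_le.1 ((Complex.abs_re_le_norm z).trans (mem_ball_zero_iff.1 hz).le)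
    rcases le_total 0 t with ht | ht
    · refine le_add_of_le_of_nonneg (Real.exp_le_exp.2 ?_) (Real.exp_pos _).le
      nlinarith
    · refine le_add_of_nonneg_of_le (Real.exp_pos _).le (Real.exp_le_exp.2 ?_)
      nlinarith

theorem cosh_mul_besselKIntegrand (ν : ℂ) (x t : ℝ) :
    (Real.cosh t : ℂ) * besselKIntegrand ν x t
      = (besselKIntegrand (ν + 1) x t + besselKIntegrand (ν - 1) x t) / 2 := by
  simp only [besselKIntegrand, add_mul, sub_mul, one_mul]
  rw [show ν * t + (t : ℂ) - x * Real.cosh t = (ν * t - x * Real.cosh t) + t by ring,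
    show ν * t - (t : ℂ) - x * Real.cosh t = (ν * t - x * Real.cosh t) + -t by ring,
    Complex.exp_add, Complex.exp_add, Complex.ofReal_cosh, Complex.cosh]
  ring

theorem sinh_mul_besselKIntegrand (ν : ℂ) (x t : ℝ) :
    (Real.sinh t : ℂ) * besselKIntegrand ν x t
      = (besselKIntegrand (ν + 1) x t - besselKIntegrand (ν - 1) x t) / 2 := by
  simp only [besselKIntegrand, add_mul, sub_mul, one_mul]
  rw [show ν * t + (t : ℂ) - x * Real.cosh t = (ν * t - x * Real.cosh t) + t by ring,
    show ν * t - (t : ℂ) - x * Real.cosh t = (ν * t - x * Real.cosh t) + -t by ring,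
    Complex.exp_add, Complex.exp_add, Complex.ofReal_sinh, Complex.sinh]
  ring

/-- `K_ν' = -(K_{ν+1} + K_{ν-1}) / 2`. -/
theorem hasDerivAt_besselKIntegral (ν : ℂ) {x : ℝ} (hx : 0 < x) :
    HasDerivAt (besselKIntegral ν)
      (-(besselKIntegral (ν + 1) x + besselKIntegral (ν - 1) x) / 2) x := by
  have hi := fun ν' => integrable_besselKIntegrand ν' hx
  have hi' := integrable_exp_sub_cosh (ν.re + 1) (half_pos hx)
  have hi'' := integrable_exp_sub_cosh (ν.re - 1) (half_pos hx)
  have key := (hasDerivAt_integral_of_dominated_loc_of_deriv_le (μ := volume) (𝕜 := ℝ)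
    (F := fun y t => besselKIntegrand ν y t) (x₀ := x) (s := Ioi (x / 2))
    (F' := fun y t => -((besselKIntegrand (ν + 1) y t + besselKIntegrand (ν - 1) y t) / 2))
    (bound := fun t => (Real.exp ((ν.re + 1) * t - x / 2 * Real.cosh t)
      + Real.exp ((ν.re - 1) * t - x / 2 * Real.cosh t)) / 2)
    (Ioi_mem_nhds (by linarith))
    (Eventually.of_forall fun y => (continuous_besselKIntegrand ν y).aestronglyMeasurable) (hi ν)
    (((hi (ν + 1)).add (hi (ν - 1))).div_const 2).neg.aestronglyMeasurable
    (Eventually.of_forall fun t y hy => ?_) ((hi'.add hi'').div_const 2)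
    (Eventually.of_forall fun t y hy => ?_)).2
  · convert! key.const_mul (1 / 2 : ℂ) using 1
    rw [integral_neg, integral_div, integral_add (hi _) (hi _)]
    simp only [besselKIntegral]
    ring
  · rw [norm_neg, norm_div, Complex.norm_ofNat]
    refine div_le_div_of_nonneg_right ((norm_add_le _ _).trans ?_) zero_le_two
    rw [norm_besselKIntegrand, norm_besselKIntegrand]
    have hc := Real.cosh_pos t
    have hy' : x / 2 < y := hy
    refine add_le_add (Real.exp_le_exp.2 ?_) (Real.exp_le_exp.2 ?_)
    · simp only [Complex.add_re, Complex.one_re]; nlinarith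
    · simp only [Complex.sub_re, Complex.one_re]; nlinarith
  · rw [← cosh_mul_besselKIntegrand]
    have h1 : HasDerivAt (fun y : ℝ => ν * t - (y : ℂ) * Real.cosh t) (-(1 * (Real.cosh t : ℂ))) y :=
      ((hasDerivAt_id y).ofReal_comp.mul_const _).const_sub _
    convert! h1.cexp using 1
    simp only [besselKIntegrand]
    ring

/-- `2 ν K_ν = x (K_{ν+1} - K_{ν-1})`. -/
theorem besselKIntegral_recurrence (ν : ℂ) {x : ℝ} (hx : 0 < x) :
    2 * ν * besselKIntegral ν x = x * (besselKIntegral (ν + 1) x - besselKIntegral (ν - 1) x) := by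
  have hi := fun ν' => integrable_besselKIntegrand ν' hx
  have hd : ∀ t : ℝ, HasDerivAt (besselKIntegrand ν x) (ν * besselKIntegrand ν x t
      - x * ((besselKIntegrand (ν + 1) x t - besselKIntegrand (ν - 1) x t) / 2)) t := by
    intro t
    rw [← sinh_mul_besselKIntegrand]
    have h1 : HasDerivAt (fun t : ℝ => ν * t - (x : ℂ) * Real.cosh t)
        (ν * 1 - x * (Real.sinh t : ℂ)) t :=
      ((hasDerivAt_id t).ofReal_comp.const_mul _).sub
        ((Real.hasDerivAt_cosh t).ofReal_comp.const_mul _)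
    convert! h1.cexp using 1
    simp only [besselKIntegrand]
    ring
  -- Integration by parts: the t-derivative of the integrand has integral zero.
  have h0 := integral_eq_zero_of_hasDerivAt_of_integrable hd
    (((hi ν).const_mul ν).sub ((((hi _).sub (hi _)).div_const 2).const_mul _)) (hi ν)
  have hi' : Integrable fun t => besselKIntegrand (ν + 1) x t - besselKIntegrand (ν - 1) x t :=
    (hi _).sub (hi _)
  rw [integral_sub ((hi ν).const_mul ν) ((hi'.div_const 2).const_mul _), integral_const_mul, integral_const_mul, integral_div, integral_sub (hi _) (hi _)] at h0
  simp only [besselKIntegral]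
  linear_combination h0

/-- `(x^ν K_ν)' = -x^ν K_{ν-1}`. -/
theorem hasDerivAt_cpow_mul_besselKIntegral (ν : ℂ) {x : ℝ} (hx : 0 < x) :
    HasDerivAt (fun y : ℝ => (y : ℂ) ^ ν * besselKIntegral ν y)
      (-((x : ℂ) ^ ν * besselKIntegral (ν - 1) x)) x := by
  have hx' : (x : ℂ) ≠ 0 := by exact_mod_cast hx.ne'
  have h1 : HasDerivAt (fun y : ℝ => (y : ℂ) ^ ν) (ν * (x : ℂ) ^ (ν - 1)) x := by
    have := (hasDerivAt_id (x : ℂ)).cpow_const (c := ν) (by simp [hx])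
    simpa using this.comp_ofReal
  convert! h1.mul (hasDerivAt_besselKIntegral ν hx) using 1
  have hrec := besselKIntegral_recurrence ν hx
  rw [Complex.cpow_sub _ _ hx', Complex.cpow_one]
  field_simp
  linear_combination (-(x : ℂ) ^ ν) * hrec

/-! ### Behaviour of x^ν K_ν at zero -/

theorem integrable_and_integral_exp_sub_exp {ν : ℂ} (hν : 0 < ν.re) :
    Integrable (fun s : ℝ => Complex.exp (ν * s - Real.exp s)) ∧
      ∫ s : ℝ, Complex.exp (ν * s - Real.exp s) = Complex.Gamma ν := by
  -- Substitution u = e^s in Euler's integral for Γ.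
  have himg : Real.exp '' univ = Ioi 0 := by rw [image_univ, Real.range_exp]
  have hder : ∀ s ∈ (univ : Set ℝ), HasDerivWithinAt Real.exp (Real.exp s) univ s :=
    fun s _ => (Real.hasDerivAt_exp s).hasDerivWithinAt
  have hpt : ∀ s : ℝ, |Real.exp s| • (((Real.exp (-Real.exp s) : ℝ) : ℂ)
      * ((Real.exp s : ℝ) : ℂ) ^ (ν - 1)) = Complex.exp (ν * s - Real.exp s) := by
    intro s
    rw [abs_of_pos (Real.exp_pos s), Complex.real_smul, Complex.ofReal_exp, Complex.ofReal_exp,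
      Complex.cpow_def_of_ne_zero (Complex.exp_ne_zero _), ← Complex.ofReal_exp s,
      ← Complex.ofReal_log (Real.exp_pos s).le, Real.log_exp, Complex.ofReal_exp s,
      ← Complex.exp_add, ← Complex.exp_add]
    congr 1
    push_cast
    ring
  constructor
  · have h := (integrableOn_image_iff_integrableOn_abs_deriv_smul MeasurableSet.univ hder
      Real.exp_injective.injOn
      (fun x : ℝ => ((Real.exp (-x) : ℝ) : ℂ) * (x : ℂ) ^ (ν - 1))).1
      (himg ▸ Complex.GammaIntegral_convergent hν)
    simpa only [hpt, integrableOn_univ] using h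
  · have h := integral_image_eq_integral_abs_deriv_smul MeasurableSet.univ hder
      Real.exp_injective.injOn (fun x : ℝ => ((Real.exp (-x) : ℝ) : ℂ) * (x : ℂ) ^ (ν - 1))
    simp only [hpt, himg, Measure.restrict_univ] at h
    rw [← h, Complex.Gamma_eq_integral hν, Complex.GammaIntegral]

/-- The shift t = s − log(x/2) turns x cosh t into e^s + (x²/4) e^{−s}. What then depends on x is a
factor at most 1 that tends to 1 as x → 0, so that dominated convergence leads to Γ(ν). -/
theorem cpow_mul_besselKIntegral_eq (ν : ℂ) {x : ℝ} (hx : 0 < x) :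
    (x : ℂ) ^ ν * besselKIntegral ν x = (2 : ℂ) ^ (ν - 1) *
      ∫ s : ℝ, Complex.exp (ν * s - Real.exp s - (x ^ 2 / 4 * Real.exp (-s) : ℝ)) := by
  have hx' : (x : ℂ) ≠ 0 := by exact_mod_cast hx.ne'
  rw [besselKIntegral, ← integral_sub_right_eq_self _ (Real.log (x / 2)), ← integral_const_mul,
    ← integral_const_mul, ← integral_const_mul]
  congr 1
  ext s
  have h1 : Real.exp (s - Real.log (x / 2)) = 2 * Real.exp s / x := by
    rw [Real.exp_sub, Real.exp_log (by positivity)]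
    field_simp
  have h2 : Real.exp (-(s - Real.log (x / 2))) = x * Real.exp (-s) / 2 := by
    rw [neg_sub, Real.exp_sub, Real.exp_log (by positivity), Real.exp_neg]
    field_simp
  have h3 : x * Real.cosh (s - Real.log (x / 2)) = Real.exp s + x ^ 2 / 4 * Real.exp (-s) := by
    rw [Real.cosh_eq, h1, h2]
    field_simp
    ring
  rw [besselKIntegrand, ← Complex.ofReal_mul, h3, Complex.cpow_sub _ _ two_ne_zero,
    Complex.cpow_one, Complex.cpow_def_of_ne_zero hx', Complex.cpow_def_of_ne_zero two_ne_zero,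
    ← Complex.ofReal_log hx.le, Real.log_div hx.ne' two_ne_zero]
  have h4 : Complex.log 2 = ((Real.log 2 : ℝ) : ℂ) := by
    rw [Complex.ofReal_log zero_le_two]; simp
  rw [h4, show ∀ a b : ℂ, a * (1 / 2 * b) = (a * b) / 2 by intros; ring,
    show ∀ a b : ℂ, a / 2 * b = (a * b) / 2 by intros; ring, ← Complex.exp_add,
    ← Complex.exp_add]
  congr 2
  push_cast
  ring

theorem tendsto_cpow_mul_besselKIntegral {ν : ℂ} (hν : 0 < ν.re) :
    Tendsto (fun x : ℝ => (x : ℂ) ^ ν * besselKIntegral ν x) (𝓝[>] 0)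
      (𝓝 ((2 : ℂ) ^ (ν - 1) * Complex.Gamma ν)) := by
  obtain ⟨hint, hval⟩ := integrable_and_integral_exp_sub_exp hν
  have key : Tendsto (fun x : ℝ =>
      ∫ s : ℝ, Complex.exp (ν * s - Real.exp s - (x ^ 2 / 4 * Real.exp (-s) : ℝ))) (𝓝[>] 0)
      (𝓝 (Complex.Gamma ν)) := by
    rw [← hval]
    refine tendsto_integral_filter_of_dominated_convergence _
      (Eventually.of_forall fun x => (by fun_prop : Continuous _).aestronglyMeasurable)
      (Eventually.of_forall fun x => Eventually.of_forall fun s => ?_) hint.norm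
      (Eventually.of_forall fun s => ?_)
    · rw [Complex.norm_exp, Complex.norm_exp, Complex.sub_re (ν * s - Real.exp s),
        Complex.ofReal_re]
      exact Real.exp_le_exp.2 (sub_le_self _ (by positivity))
    · have hc : Continuous fun x : ℝ =>
          Complex.exp (ν * s - Real.exp s - (x ^ 2 / 4 * Real.exp (-s) : ℝ)) := by fun_prop
      simpa using (hc.tendsto 0).mono_left nhdsWithin_le_nhds
  refine (key.const_mul _).congr' ?_
  filter_upwards [self_mem_nhdsWithin] with x hx
  exact (cpow_mul_besselKIntegral_eq ν hx).symm

/-! ### The power series of I_ν -/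

/-- The entire series `∑ yᵐ / (m! Γ(m+ν+1))`. -/
noncomputable def besselSeries (ν y : ℂ) : ℂ :=
  ∑' m : ℕ, y ^ m / ((m ! : ℂ) * Complex.Gamma ((m : ℂ) + ν + 1))

/-- Compactness bounds the entire function 1/Γ for the finitely many m ≤ N. From N ≥ R + 1 on,
1/Γ(z) = z/Γ(z+1) with |z| ≥ 1 shows that the norm does not increase with m. -/
theorem exists_norm_inv_Gamma_le (R : ℝ) :
    ∃ C : ℝ, 0 ≤ C ∧ ∀ (m : ℕ) (ν : ℂ), ‖ν‖ ≤ R → ‖(Complex.Gamma ((m : ℂ) + ν + 1))⁻¹‖ ≤ C := by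
  have hcpt : IsCompact (Metric.closedBall (0 : ℂ) R) := isCompact_closedBall 0 R
  have hex : ∀ m : ℕ, ∃ C : ℝ, ∀ ν ∈ Metric.closedBall (0 : ℂ) R,
      ‖(Complex.Gamma ((m : ℂ) + ν + 1))⁻¹‖ ≤ C := fun m =>
    hcpt.exists_bound_of_continuousOn (Complex.differentiable_one_div_Gamma.continuous.comp
      (by fun_prop : Continuous fun ν : ℂ => (m : ℂ) + ν + 1)).continuousOn
  choose B hB using hex
  obtain ⟨N, hN⟩ := exists_nat_ge (R + 1)
  refine ⟨∑ m ∈ Finset.range (N + 1), |B m|, Finset.sum_nonneg fun _ _ => abs_nonneg _, ?_⟩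
  have hle : ∀ m ≤ N, ∀ ν : ℂ, ‖ν‖ ≤ R →
      ‖(Complex.Gamma ((m : ℂ) + ν + 1))⁻¹‖ ≤ ∑ m ∈ Finset.range (N + 1), |B m| := by
    intro m hm ν hν
    refine (hB m ν (by simpa using hν)).trans ((le_abs_self _).trans ?_)
    exact Finset.single_le_sum (f := fun m => |B m|) (fun _ _ => abs_nonneg _)
      (Finset.mem_range.2 (by omega))
  intro m ν hν
  rcases le_total m N with hm | hm
  · exact hle m hm ν hν
  · induction m, hm using Nat.le_induction with
    | base => exact hle N le_rfl ν hν
    | succ m hm ih =>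
      have hre : 1 ≤ ((m : ℂ) + ν + 1).re := by
        have h1 := (abs_le.1 ((Complex.abs_re_le_norm ν).trans hν)).1
        have h2 : (N : ℝ) ≤ m := by exact_mod_cast hm
        simp only [Complex.add_re, Complex.natCast_re, Complex.one_re]
        linarith
      have hnorm : 1 ≤ ‖(m : ℂ) + ν + 1‖ := hre.trans (Complex.re_le_norm _)
      refine le_trans ?_ ih
      rw [Complex.one_div_Gamma_eq_self_mul_one_div_Gamma_add_one ((m : ℂ) + ν + 1), norm_mul]
      push_cast
      rw [show (m : ℂ) + 1 + ν + 1 = (m : ℂ) + ν + 1 + 1 by ring]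
      exact le_mul_of_one_le_left (norm_nonneg _) hnorm

theorem norm_besselSeries_term_le {C : ℝ} {ν y : ℂ} {m : ℕ} {r : ℝ}
    (hC : ‖(Complex.Gamma ((m : ℂ) + ν + 1))⁻¹‖ ≤ C) (hy : ‖y‖ ≤ r) :
    ‖y ^ m / ((m ! : ℂ) * Complex.Gamma ((m : ℂ) + ν + 1))‖ ≤ C * (r ^ m / m !) := by
  rw [← div_div, div_eq_mul_inv, norm_mul, norm_div, norm_pow, Complex.norm_natCast, mul_comm]
  have := (norm_nonneg _).trans hC
  have := (norm_nonneg _).trans hy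
  gcongr

theorem summable_besselSeries (ν y : ℂ) :
    Summable fun m : ℕ => y ^ m / ((m ! : ℂ) * Complex.Gamma ((m : ℂ) + ν + 1)) := by
  obtain ⟨C, _, hC⟩ := exists_norm_inv_Gamma_le ‖ν‖
  exact Summable.of_norm_bounded ((Real.summable_pow_div_factorial ‖y‖).mul_left C)
    fun m => norm_besselSeries_term_le (hC m ν le_rfl) le_rfl

theorem differentiable_besselSeries_order (y : ℂ) : Differentiable ℂ fun ν => besselSeries ν y := by
  intro ν₀
  obtain ⟨C, _, hC⟩ := exists_norm_inv_Gamma_le (‖ν₀‖ + 1)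
  have hν₀ : ν₀ ∈ Metric.ball (0 : ℂ) (‖ν₀‖ + 1) := by simp
  refine (Complex.differentiableOn_tsum_of_summable_norm
    ((Real.summable_pow_div_factorial ‖y‖).mul_left C) (fun m => ?_) Metric.isOpen_ball
    fun m ν hν => norm_besselSeries_term_le (hC m ν (mem_ball_zero_iff.1 hν).le)
      le_rfl).differentiableAt (Metric.isOpen_ball.mem_nhds hν₀)
  simp only [← div_div, div_eq_mul_inv _ (Complex.Gamma _)]
  exact ((Complex.differentiable_one_div_Gamma.comp
    (by fun_prop : Differentiable ℂ fun ν : ℂ => (m : ℂ) + ν + 1)).const_mul _).differentiableOn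

theorem besselSeries_term_succ (ν y : ℂ) (m : ℕ) :
    ((m + 1 : ℕ) : ℂ) * y ^ m / (((m + 1)! : ℂ) * Complex.Gamma (((m + 1 : ℕ) : ℂ) + ν + 1))
      = y ^ m / ((m ! : ℂ) * Complex.Gamma ((m : ℂ) + (ν + 1) + 1)) := by
  have h1 : ((m + 1 : ℕ) : ℂ) ≠ 0 := by exact_mod_cast m.succ_ne_zero
  rw [Nat.factorial_succ, Nat.cast_mul, mul_assoc, mul_div_mul_left _ _ h1]
  push_cast
  rw [show (m : ℂ) + 1 + ν + 1 = m + (ν + 1) + 1 by ring]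

theorem hasDerivAt_besselSeries (ν y : ℂ) :
    HasDerivAt (besselSeries ν) (besselSeries (ν + 1) y) y := by
  obtain ⟨C, hC0, hC⟩ := exists_norm_inv_Gamma_le ‖ν‖
  set r := ‖y‖ + 1
  have hy : y ∈ Metric.ball (0 : ℂ) r := by simp [r]
  have hsum : Summable fun m : ℕ => C * (m * r ^ (m - 1) / m !) := by
    rw [← summable_nat_add_iff 1]
    refine ((Real.summable_pow_div_factorial r).mul_left C).congr fun m => ?_
    rw [Nat.factorial_succ, Nat.add_sub_cancel]
    push_cast
    field_simp
  have key := hasDerivAt_tsum_of_isPreconnected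
    (g := fun (m : ℕ) (y : ℂ) => y ^ m / ((m ! : ℂ) * Complex.Gamma ((m : ℂ) + ν + 1)))
    (g' := fun (m : ℕ) (y : ℂ) =>
      m * y ^ (m - 1) / ((m ! : ℂ) * Complex.Gamma ((m : ℂ) + ν + 1)))
    hsum Metric.isOpen_ball (convex_ball (0 : ℂ) r).isPreconnected
    (fun m z _ => (hasDerivAt_pow m z).div_const _) (fun m z hz => ?_) hy
    (summable_besselSeries ν y) hy
  · convert! key using 1
    -- The term m = 0, where the exponent m − 1 truncates, vanishes through its factor m; the others
    -- are reindexed.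
    rw [Summable.tsum_eq_zero_add]
    · simp only [Nat.cast_zero, zero_mul, zero_div, zero_add, Nat.add_sub_cancel,
        besselSeries_term_succ]
      rfl
    · rw [← summable_nat_add_iff 1]
      simpa only [Nat.add_sub_cancel, besselSeries_term_succ] using
        summable_besselSeries (ν + 1) y
  · rw [← div_div, div_eq_mul_inv, norm_mul, norm_div, norm_mul, norm_pow, Complex.norm_natCast,
      Complex.norm_natCast, mul_comm]
    have hz' := (mem_ball_zero_iff.1 hz).le
    have := hC m ν le_rfl
    gcongr

/-- Termwise 1/Γ(m+ν) = (m+ν)/Γ(m+ν+1), valid also at the poles; the factor m cancels against m! and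
shifts the index. -/
theorem besselSeries_recurrence (ν y : ℂ) :
    besselSeries (ν - 1) y = ν * besselSeries ν y + y * besselSeries (ν + 1) y := by
  have hterm : ∀ m : ℕ, y ^ m / ((m ! : ℂ) * Complex.Gamma ((m : ℂ) + (ν - 1) + 1))
      = ν * (y ^ m / ((m ! : ℂ) * Complex.Gamma ((m : ℂ) + ν + 1)))
        + m * (y ^ m / ((m ! : ℂ) * Complex.Gamma ((m : ℂ) + ν + 1))) := by
    intro m
    have h := Complex.one_div_Gamma_eq_self_mul_one_div_Gamma_add_one ((m : ℂ) + ν)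
    rw [show (m : ℂ) + (ν - 1) + 1 = m + ν by ring, ← div_div, ← div_div, div_eq_mul_inv _
      (Complex.Gamma _), h, div_eq_mul_inv _ (Complex.Gamma _)]
    ring
  have hs1 := (summable_besselSeries ν y).mul_left ν
  have hs2 : Summable fun m : ℕ =>
      (m : ℂ) * (y ^ m / ((m ! : ℂ) * Complex.Gamma ((m : ℂ) + ν + 1))) :=
    ((summable_besselSeries (ν - 1) y).sub hs1).congr fun m => by rw [hterm]; ring
  have h2 : ∑' m : ℕ, (m : ℂ) * (y ^ m / ((m ! : ℂ) * Complex.Gamma ((m : ℂ) + ν + 1)))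
      = y * besselSeries (ν + 1) y := by
    rw [hs2.tsum_eq_zero_add, Nat.cast_zero, zero_mul, zero_add, besselSeries, ← tsum_mul_left]
    refine tsum_congr fun m => ?_
    rw [← besselSeries_term_succ]
    ring
  rw [← h2]
  simp only [besselSeries, hterm]
  rw [hs1.tsum_add hs2, tsum_mul_left]

theorem besselSeries_zero (ν : ℂ) : besselSeries ν 0 = (Complex.Gamma (ν + 1))⁻¹ := by
  rw [besselSeries, tsum_eq_single 0 fun m hm => by simp [hm]]
  simp

/-! ### I_ν on the half-line: derivatives and limits at zero -/

theorem besselI_ofReal (ν : ℂ) {x : ℝ} (hx : 0 < x) :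
    besselI ν x = (2 : ℂ) ^ (-ν) * (x : ℂ) ^ ν * besselSeries ν (x ^ 2 / 4) := by
  have hx' : (x : ℂ) / 2 ≠ 0 := div_ne_zero (by exact_mod_cast hx.ne') two_ne_zero
  have h2 : ((x : ℂ) / 2) ^ ν = (2 : ℂ) ^ (-ν) * (x : ℂ) ^ ν := by
    have := Complex.mul_cpow_ofReal_nonneg (a := x) (b := 1 / 2) hx.le (by norm_num) ν
    push_cast at this
    rw [div_eq_mul_one_div, this, one_div, Complex.inv_cpow, Complex.cpow_neg, mul_comm]
    rw [show (2 : ℂ) = ((2 : ℝ) : ℂ) by norm_num, Complex.arg_ofReal_of_nonneg zero_le_two]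
    exact Real.pi_pos.ne
  rw [besselI, besselSeries, ← h2, ← tsum_mul_left]
  refine tsum_congr fun m => ?_
  rw [Complex.cpow_add _ _ hx', show (2 * (m : ℂ)) = ((2 * m : ℕ) : ℂ) by push_cast; ring,
    Complex.cpow_natCast, pow_mul]
  ring

theorem differentiable_besselI_order {x : ℝ} (hx : 0 < x) :
    Differentiable ℂ fun ν => besselI ν x := by
  have hx' : (x : ℂ) ≠ 0 := by exact_mod_cast hx.ne'
  simp only [besselI_ofReal _ hx]
  refine Differentiable.mul (Differentiable.mul ?_ ?_) (differentiable_besselSeries_order _)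
  · exact differentiable_neg.const_cpow (Or.inl two_ne_zero)
  · exact differentiable_id.const_cpow (Or.inl hx')

theorem hasDerivAt_besselSeries_sq_div_four (ν : ℂ) (x : ℝ) :
    HasDerivAt (fun y : ℝ => besselSeries ν ((y : ℂ) ^ 2 / 4))
      (besselSeries (ν + 1) ((x : ℂ) ^ 2 / 4) * (x / 2)) x := by
  have h1 : HasDerivAt (fun z : ℂ => z ^ 2 / 4) ((x : ℂ) / 2) x := by
    convert! (hasDerivAt_pow 2 (x : ℂ)).div_const 4 using 1
    norm_num
    ring
  exact ((hasDerivAt_besselSeries ν _).comp (x : ℂ) h1).comp_ofReal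

theorem cpow_mul_besselI_eq (ν : ℂ) {x : ℝ} (hx : 0 < x) :
    (x : ℂ) ^ ν * besselI ν x = (2 : ℂ) ^ (-ν) * (x : ℂ) ^ (2 * ν)
      * besselSeries ν (x ^ 2 / 4) := by
  have hx' : (x : ℂ) ≠ 0 := by exact_mod_cast hx.ne'
  rw [besselI_ofReal ν hx, two_mul, Complex.cpow_add _ _ hx']
  ring

theorem cpow_mul_besselI_neg_eq (ν : ℂ) {x : ℝ} (hx : 0 < x) :
    (x : ℂ) ^ ν * besselI (-ν) x = (2 : ℂ) ^ ν * besselSeries (-ν) (x ^ 2 / 4) := by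
  have hx' : (x : ℂ) ≠ 0 := by exact_mod_cast hx.ne'
  have h : (x : ℂ) ^ ν ≠ 0 := by simp [Complex.cpow_eq_zero_iff, hx']
  rw [besselI_ofReal _ hx, neg_neg, Complex.cpow_neg]
  field_simp

/-- `(x^ν I_ν)' = x^ν I_{ν-1}`. -/
theorem hasDerivAt_cpow_mul_besselI (ν : ℂ) {x : ℝ} (hx : 0 < x) :
    HasDerivAt (fun y : ℝ => (y : ℂ) ^ ν * besselI ν y) ((x : ℂ) ^ ν * besselI (ν - 1) x) x := by
  have hx' : (x : ℂ) ≠ 0 := by exact_mod_cast hx.ne'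
  have h1 : HasDerivAt (fun y : ℝ => (y : ℂ) ^ (2 * ν)) (2 * ν * (x : ℂ) ^ (2 * ν - 1)) x := by
    have := (hasDerivAt_id (x : ℂ)).cpow_const (c := 2 * ν) (by simp [hx])
    simpa using this.comp_ofReal
  have h2 := (h1.const_mul ((2 : ℂ) ^ (-ν))).mul (hasDerivAt_besselSeries_sq_div_four ν x)
  refine HasDerivAt.congr_of_eventuallyEq (HasDerivAt.congr_deriv h2 ?_)
    (Filter.eventually_of_mem (Ioi_mem_nhds hx) fun y hy => cpow_mul_besselI_eq ν hy)
  rw [besselI_ofReal _ hx, besselSeries_recurrence, neg_sub, sub_eq_add_neg (1 : ℂ) ν,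
    Complex.cpow_add _ _ two_ne_zero, Complex.cpow_sub _ _ hx', Complex.cpow_sub _ _ hx', two_mul,
    Complex.cpow_add _ _ hx', Complex.cpow_one, Complex.cpow_one]
  field_simp
  ring

/-- `(x^ν I_{-ν})' = x^ν I_{1-ν}`. -/
theorem hasDerivAt_cpow_mul_besselI_neg (ν : ℂ) {x : ℝ} (hx : 0 < x) :
    HasDerivAt (fun y : ℝ => (y : ℂ) ^ ν * besselI (-ν) y) ((x : ℂ) ^ ν * besselI (1 - ν) x) x := by
  have hx' : (x : ℂ) ≠ 0 := by exact_mod_cast hx.ne'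
  have h := (hasDerivAt_besselSeries_sq_div_four (-ν) x).const_mul ((2 : ℂ) ^ ν)
  refine HasDerivAt.congr_of_eventuallyEq (HasDerivAt.congr_deriv h ?_)
    (Filter.eventually_of_mem (Ioi_mem_nhds hx) fun y hy => cpow_mul_besselI_neg_eq ν hy)
  have h0 : (x : ℂ) ^ ν ≠ 0 := by simp [Complex.cpow_eq_zero_iff, hx']
  rw [besselI_ofReal _ hx, neg_sub, Complex.cpow_sub _ _ two_ne_zero, Complex.cpow_sub _ _ hx',
    Complex.cpow_one, Complex.cpow_one, neg_add_eq_sub]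
  field_simp

theorem tendsto_besselSeries_sq_div_four (ν : ℂ) :
    Tendsto (fun x : ℝ => besselSeries ν ((x : ℂ) ^ 2 / 4)) (𝓝[>] 0)
      (𝓝 (Complex.Gamma (ν + 1))⁻¹) := by
  have h := (hasDerivAt_besselSeries_sq_div_four ν 0).continuousAt.tendsto
  simp only [Complex.ofReal_zero, ne_eq, OfNat.ofNat_ne_zero, not_false_eq_true, zero_pow,
    zero_div, besselSeries_zero] at h
  exact h.mono_left nhdsWithin_le_nhds

theorem tendsto_cpow_mul_besselI {ν : ℂ} (hν : 0 < ν.re) :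
    Tendsto (fun x : ℝ => (x : ℂ) ^ ν * besselI ν x) (𝓝[>] 0) (𝓝 0) := by
  have h0 : Tendsto (fun x : ℝ => (x : ℂ) ^ (2 * ν)) (𝓝[>] 0) (𝓝 0) := by
    have hne : 2 * ν ≠ 0 := by rintro h; simp at h; simp [h] at hν
    have h := (Complex.continuousAt_ofReal_cpow_const 0 (2 * ν) (Or.inl (by simpa using hν))).tendsto
    rw [Complex.ofReal_zero, Complex.zero_cpow hne] at h
    exact h.mono_left nhdsWithin_le_nhds
  have h1 := (h0.const_mul ((2 : ℂ) ^ (-ν))).mul (tendsto_besselSeries_sq_div_four ν)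
  rw [mul_zero, zero_mul] at h1
  refine h1.congr' ?_
  filter_upwards [self_mem_nhdsWithin] with x hx
  exact (cpow_mul_besselI_eq ν hx).symm

theorem tendsto_cpow_mul_besselI_neg (ν : ℂ) :
    Tendsto (fun x : ℝ => (x : ℂ) ^ ν * besselI (-ν) x) (𝓝[>] 0)
      (𝓝 ((2 : ℂ) ^ ν * (Complex.Gamma (1 - ν))⁻¹)) := by
  have h1 := (tendsto_besselSeries_sq_div_four (-ν)).const_mul ((2 : ℂ) ^ ν)
  rw [neg_add_eq_sub] at h1
  refine h1.congr' ?_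
  filter_upwards [self_mem_nhdsWithin] with x hx
  exact (cpow_mul_besselI_neg_eq ν hx).symm

/-! ### Identification of the Macdonald function with the integral -/

/-- A solution of `a' = -p b`, `b' = -q a` on the half-line with `p` and `q` integrable at `0`
vanishes if it tends to zero at `0`. -/
theorem eq_zero_of_hasDerivAt_system {a b : ℝ → ℂ} {p q Φ : ℝ → ℝ} {L : ℝ}
    (ha : ∀ x, 0 < x → HasDerivAt a (-(p x * b x)) x)
    (hb : ∀ x, 0 < x → HasDerivAt b (-(q x * a x)) x)
    (hp : ∀ x, 0 < x → 0 ≤ p x) (hq : ∀ x, 0 < x → 0 ≤ q x)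
    (hΦ : ∀ x, 0 < x → HasDerivAt Φ (p x + q x) x) (hΦ0 : Tendsto Φ (𝓝[>] 0) (𝓝 L))
    (ha0 : Tendsto a (𝓝[>] 0) (𝓝 0)) (hb0 : Tendsto b (𝓝[>] 0) (𝓝 0)) {x : ℝ} (hx : 0 < x) :
    a x = 0 := by
  -- Grönwall: the derivative of |a|² + |b|² is at most 2(p+q)|a||b| ≤ (p+q)(|a|² + |b|²), so the
  -- weight e^{−Φ} makes M antitone. Its limit at 0 is zero, hence M ≤ 0.
  set M : ℝ → ℝ := fun y => (‖a y‖ ^ 2 + ‖b y‖ ^ 2) * Real.exp (-Φ y) with hM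
  have hderiv : ∀ y, 0 < y → ∃ d ≤ 0, HasDerivAt M d y := by
    intro y hy
    refine ⟨_, ?_, ((ha y hy).norm_sq.add (hb y hy).norm_sq).mul (hΦ y hy).neg.exp⟩
    have h1 : inner ℝ (a y) (-(p y * b y)) ≤ p y * (‖a y‖ * ‖b y‖) := by
      refine (real_inner_le_norm _ _).trans_eq ?_
      rw [norm_neg, norm_mul, Complex.norm_real, Real.norm_eq_abs, abs_of_nonneg (hp y hy)]
      ring
    have h2 : inner ℝ (b y) (-(q y * a y)) ≤ q y * (‖a y‖ * ‖b y‖) := by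
      refine (real_inner_le_norm _ _).trans_eq ?_
      rw [norm_neg, norm_mul, Complex.norm_real, Real.norm_eq_abs, abs_of_nonneg (hq y hy)]
      ring
    have h3 := two_mul_le_add_sq ‖a y‖ ‖b y‖
    have h4 := mul_le_mul_of_nonneg_left h3 (add_nonneg (hp y hy) (hq y hy))
    have h5 := Real.exp_pos (-Φ y)
    have h6 : 2 * inner ℝ (a y) (-(p y * b y)) + 2 * inner ℝ (b y) (-(q y * a y))
        - (‖a y‖ ^ 2 + ‖b y‖ ^ 2) * (p y + q y) ≤ 0 := by linarith
    have h7 := mul_nonpos_of_nonpos_of_nonneg h6 h5.le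
    simp only [Pi.add_apply, Pi.neg_apply]
    linarith
  have hanti : AntitoneOn M (Ioi 0) := by
    refine antitoneOn_of_deriv_nonpos (convex_Ioi 0) ?_ ?_ ?_
    · intro y hy
      obtain ⟨d, -, h⟩ := hderiv y hy
      exact h.continuousAt.continuousWithinAt
    · rw [interior_Ioi]
      intro y hy
      obtain ⟨d, -, h⟩ := hderiv y hy
      exact h.differentiableAt.differentiableWithinAt
    · rw [interior_Ioi]
      intro y hy
      obtain ⟨d, hd, h⟩ := hderiv y hy
      exact h.deriv.trans_le hd
  have hlim : Tendsto M (𝓝[>] 0) (𝓝 0) := by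
    have h := ((ha0.norm.pow 2).add (hb0.norm.pow 2)).mul
      ((Real.continuous_exp.tendsto _).comp hΦ0.neg)
    simpa using h
  have hMx : M x ≤ 0 := by
    refine ge_of_tendsto hlim ?_
    filter_upwards [Ioo_mem_nhdsGT hx] with y hy
    exact hanti hy.1 hx hy.2.le
  have h : ‖a x‖ ^ 2 + ‖b x‖ ^ 2 ≤ 0 := nonpos_of_mul_nonpos_left hMx (Real.exp_pos _)
  have : ‖a x‖ ^ 2 = 0 := by nlinarith [sq_nonneg ‖a x‖, sq_nonneg ‖b x‖]
  simpa using this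

theorem macdonaldQuotient_neg (ν z : ℂ) : macdonaldQuotient (-ν) z = macdonaldQuotient ν z := by
  rw [macdonaldQuotient, macdonaldQuotient, neg_neg, neg_mul, Complex.sin_neg, mul_neg, div_neg]
  ring

/-- The same relation as for the integral. The minus sign comes from sin(νπ − π) = −sin νπ; at
integers both sides are zero because division by zero gives zero. -/
theorem hasDerivAt_cpow_mul_macdonaldQuotient (ν : ℂ) {x : ℝ} (hx : 0 < x) :
    HasDerivAt (fun y : ℝ => (y : ℂ) ^ ν * macdonaldQuotient ν y)
      (-((x : ℂ) ^ ν * macdonaldQuotient (ν - 1) x)) x := by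
  have h := ((hasDerivAt_cpow_mul_besselI_neg ν hx).sub
    (hasDerivAt_cpow_mul_besselI ν hx)).const_mul
      ((Real.pi : ℂ) / (2 * Complex.sin (ν * Real.pi)))
  convert! h using 1
  · ext y
    simp only [macdonaldQuotient, Pi.sub_apply]
    ring
  · rw [macdonaldQuotient, sub_mul, one_mul, Complex.sin_sub_pi, neg_sub, mul_neg, div_neg]
    ring

/-- Only I_{−ν} contributes, and the reflection formula turns its constant into the limit found for
the integral. -/
theorem tendsto_cpow_mul_macdonaldQuotient {ν : ℂ} (h0 : 0 < ν.re) (h1 : ν.re < 1) :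
    Tendsto (fun x : ℝ => (x : ℂ) ^ ν * macdonaldQuotient ν x) (𝓝[>] 0)
      (𝓝 ((2 : ℂ) ^ (ν - 1) * Complex.Gamma ν)) := by
  have h := ((tendsto_cpow_mul_besselI_neg ν).sub (tendsto_cpow_mul_besselI h0)).const_mul
    ((Real.pi : ℂ) / (2 * Complex.sin (ν * Real.pi)))
  have hG : Complex.Gamma (1 - ν) ≠ 0 := Complex.Gamma_ne_zero_of_re_pos (by simpa using h1)
  convert! h using 1
  · ext y
    simp only [macdonaldQuotient]
    ring
  · have := Complex.Gamma_mul_Gamma_one_sub ν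
    rw [sub_zero, ← div_div, div_right_comm, mul_comm ν, ← this, Complex.cpow_sub _ _ two_ne_zero,
      Complex.cpow_one]
    congr 1
    field_simp

/-- Evenness replaces order σ − 1 by 1 − σ, again in (0,1), which closes the system for the two
differences. The coefficients y^{2σ−1} and y^{1−2σ} are integrable at 0 exactly because 0 < σ < 1.
-/
theorem macdonaldQuotient_eq_of_mem_Ioo {σ : ℝ} (h0 : 0 < σ) (h1 : σ < 1) {x : ℝ} (hx : 0 < x) :
    besselKIntegral σ x = macdonaldQuotient σ x := by
  set w : ℝ → ℝ → ℂ := fun σ y =>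
    (y : ℂ) ^ (σ : ℂ) * besselKIntegral σ y - (y : ℂ) ^ (σ : ℂ) * macdonaldQuotient σ y with hw
  have hderiv : ∀ σ y : ℝ, 0 < y →
      HasDerivAt (w σ) (-((y ^ (2 * σ - 1) : ℝ) * w (1 - σ) y)) y := by
    intro σ y hy
    have hy' : (y : ℂ) ≠ 0 := by exact_mod_cast hy.ne'
    convert! (hasDerivAt_cpow_mul_besselKIntegral σ hy).sub
      (hasDerivAt_cpow_mul_macdonaldQuotient σ hy) using 1
    have hpow : ((y ^ (2 * σ - 1) : ℝ) : ℂ) * (y : ℂ) ^ (((1 - σ : ℝ)) : ℂ)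
        = (y : ℂ) ^ (σ : ℂ) := by
      rw [Complex.ofReal_cpow hy.le, ← Complex.cpow_add _ _ hy']
      congr 1
      push_cast
      ring
    rw [← besselKIntegral_neg (σ - 1), ← macdonaldQuotient_neg (σ - 1), neg_sub]
    simp only [hw]
    rw [← mul_sub, ← mul_assoc, hpow]
    push_cast
    ring
  have hlim : ∀ σ : ℝ, 0 < σ → σ < 1 → Tendsto (w σ) (𝓝[>] 0) (𝓝 0) := by
    intro σ h0 h1
    have h := (tendsto_cpow_mul_besselKIntegral (ν := (σ : ℂ)) (by simpa using h0)).sub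
      (tendsto_cpow_mul_macdonaldQuotient (ν := (σ : ℂ)) (by simpa using h0) (by simpa using h1))
    rwa [sub_self] at h
  have hΦ : ∀ τ : ℝ, 0 < τ → ∀ y : ℝ, 0 < y →
      HasDerivAt (fun y : ℝ => y ^ τ / τ) (y ^ (τ - 1)) y := by
    intro τ hτ y hy
    convert! (Real.hasDerivAt_rpow_const (p := τ) (Or.inl hy.ne')).div_const τ using 1
    field_simp
  have hΦ0 : ∀ τ : ℝ, 0 < τ → Tendsto (fun y : ℝ => y ^ τ / τ) (𝓝[>] 0) (𝓝 (0 ^ τ / τ)) := by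
    intro τ hτ
    exact ((Real.continuousAt_rpow_const 0 τ (Or.inr hτ.le)).tendsto.mono_left
      nhdsWithin_le_nhds).div_const τ
  have hzero := eq_zero_of_hasDerivAt_system (a := w σ) (b := w (1 - σ))
    (p := fun y => y ^ (2 * σ - 1)) (q := fun y => y ^ (2 * (1 - σ) - 1))
    (hderiv σ) (fun y hy => by simpa only [sub_sub_cancel] using hderiv (1 - σ) y hy)
    (fun y hy => (Real.rpow_pos_of_pos hy _).le) (fun y hy => (Real.rpow_pos_of_pos hy _).le)
    (fun y hy => (hΦ (2 * σ) (by linarith) y hy).add (hΦ (2 * (1 - σ)) (by linarith) y hy))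
    ((hΦ0 (2 * σ) (by linarith)).add (hΦ0 (2 * (1 - σ)) (by linarith)))
    (hlim σ h0 h1) (hlim (1 - σ) (by linarith) (by linarith)) hx
  have hx' : (x : ℂ) ^ (σ : ℂ) ≠ 0 := by simp [Complex.cpow_eq_zero_iff, hx.ne']
  simp only [hw, ← mul_sub] at hzero
  exact sub_eq_zero.1 ((mul_eq_zero.1 hzero).resolve_left hx')

/-- Clearing the sine makes both sides entire in ν; they agree at real σ accumulating at 1/2, hence
everywhere. -/
theorem two_sin_mul_besselKIntegral (ν : ℂ) {x : ℝ} (hx : 0 < x) :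
    2 * Complex.sin (ν * Real.pi) * besselKIntegral ν x
      = Real.pi * (besselI (-ν) x - besselI ν x) := by
  have hI := differentiable_besselI_order hx
  have hF : AnalyticOnNhd ℂ
      (fun ν : ℂ => 2 * Complex.sin (ν * Real.pi) * besselKIntegral ν x) univ :=
    DifferentiableOn.analyticOnNhd ((by fun_prop :
      Differentiable ℂ fun ν : ℂ => 2 * Complex.sin (ν * Real.pi)).mul
        (differentiable_besselKIntegral hx)).differentiableOn isOpen_univ
  have hG : AnalyticOnNhd ℂ
      (fun ν : ℂ => (Real.pi : ℂ) * (besselI (-ν) x - besselI ν x)) univ :=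
    DifferentiableOn.analyticOnNhd
      (((hI.comp differentiable_neg).sub hI).const_mul _).differentiableOn isOpen_univ
  have hev : ∀ᶠ σ : ℝ in 𝓝[≠] (1 / 2), 2 * Complex.sin ((σ : ℂ) * Real.pi) * besselKIntegral σ x
      = Real.pi * (besselI (-σ) x - besselI σ x) := by
    have hmem : Ioo (0 : ℝ) 1 ∈ 𝓝 (1 / 2 : ℝ) := Ioo_mem_nhds (by norm_num) (by norm_num)
    filter_upwards [mem_nhdsWithin_of_mem_nhds hmem] with σ hσ
    have hsin : Complex.sin ((σ : ℂ) * Real.pi) ≠ 0 := by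
      have := Real.sin_pos_of_pos_of_lt_pi (x := σ * Real.pi) (mul_pos hσ.1 Real.pi_pos)
        (by nlinarith [Real.pi_pos, hσ.2])
      rw [← Complex.ofReal_mul, ← Complex.ofReal_sin]
      exact_mod_cast this.ne'
    rw [macdonaldQuotient_eq_of_mem_Ioo hσ.1 hσ.2 hx, macdonaldQuotient]
    field_simp
  have htend : Tendsto (fun σ : ℝ => (σ : ℂ)) (𝓝[≠] (1 / 2)) (𝓝[≠] ((1 / 2 : ℝ) : ℂ)) :=
    (Complex.continuous_ofReal.tendsto _).inf (tendsto_principal_principal.2 fun σ hσ => by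
      simpa only [mem_compl_iff, mem_singleton_iff, Complex.ofReal_inj] using hσ)
  exact congrFun (hF.eq_of_frequently_eq hG (htend.frequently hev.frequently)) ν

theorem macdonaldQuotient_eq {ν : ℂ} (hν : ¬∃ n : ℤ, ν = n) {x : ℝ} (hx : 0 < x) :
    macdonaldQuotient ν x = besselKIntegral ν x := by
  have hsin : Complex.sin (ν * Real.pi) ≠ 0 := by
    intro h
    obtain ⟨k, hk⟩ := Complex.sin_eq_zero_iff.1 h
    exact hν ⟨k, mul_right_cancel₀ (Complex.ofReal_ne_zero.2 Real.pi_ne_zero) hk⟩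
  rw [macdonaldQuotient, div_mul_eq_mul_div, ← two_sin_mul_besselKIntegral ν hx]
  field_simp

/-- The integral representation of the Macdonald function. -/
theorem macdonaldK_eq (ν : ℂ) {x : ℝ} (hx : 0 < x) :
    macdonaldK ν x = besselKIntegral ν x := by
  rw [macdonaldK]
  split_ifs with h
  · obtain ⟨n, rfl⟩ := h
    refine Tendsto.limUnder_eq ((((differentiable_besselKIntegral hx).continuous.tendsto
      (n : ℂ)).mono_left nhdsWithin_le_nhds).congr' ?_)
    -- The punctured unit disc about n contains no integer, so there the quotient is the integral,
    -- which is continuous at n.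
    filter_upwards [mem_nhdsWithin_of_mem_nhds (Metric.ball_mem_nhds (n : ℂ) one_pos),
      self_mem_nhdsWithin] with μ hμ hne
    refine (macdonaldQuotient_eq ?_ hx).symm
    rintro ⟨m, rfl⟩
    rw [Metric.mem_ball, Complex.dist_eq, ← Int.cast_sub, Complex.norm_intCast] at hμ
    have h1 : |m - n| < 1 := by exact_mod_cast hμ
    exact hne (by rw [mem_singleton_iff, sub_eq_zero.1 (Int.abs_lt_one_iff.1 h1)])
  · exact macdonaldQuotient_eq h hx

/-! ### Vanishing of the boundary terms -/

theorem tendsto_besselKReal_zero_atTop : Tendsto (besselKReal 0) (𝓝[>] 0) atTop := by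
  refine tendsto_atTop.2 fun B => ?_
  -- Keeping only |t| ≤ T gives K_0(x) ≥ T exp(−x cosh T), which tends to T > B as x → 0.
  set T : ℝ := |B| + 1
  have hT : 0 < T := by positivity
  have hc : Tendsto (fun x : ℝ => T * Real.exp (-(x * Real.cosh T))) (𝓝[>] 0) (𝓝 T) := by
    have h : Continuous fun x : ℝ => T * Real.exp (-(x * Real.cosh T)) := by fun_prop
    simpa using (h.tendsto 0).mono_left (nhdsWithin_le_nhds (s := Ioi (0 : ℝ)))
  have hB : B < T := (le_abs_self B).trans_lt (lt_add_one _)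
  filter_upwards [hc.eventually_const_lt hB, self_mem_nhdsWithin] with x hx hx0
  have hx0' : 0 < x := hx0
  refine hx.le.trans ?_
  have hint := integrable_exp_sub_cosh 0 hx0'
  have h1 : ∫ t in Icc (-T) T, Real.exp (-(x * Real.cosh T))
      ≤ ∫ t in Icc (-T) T, Real.exp (0 * t - x * Real.cosh t) := by
    refine setIntegral_mono_on (integrableOn_const (by simp)) hint.integrableOn
      measurableSet_Icc fun t ht => Real.exp_le_exp.2 ?_
    have : Real.cosh t ≤ Real.cosh T := Real.cosh_le_cosh.2 (by
      rw [abs_of_pos hT]; exact abs_le.2 ht)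
    nlinarith
  have h2 := setIntegral_le_integral (s := Icc (-T) T) hint
    (Eventually.of_forall fun t => (Real.exp_pos _).le)
  rw [setIntegral_const, measureReal_def, Real.volume_Icc, ENNReal.toReal_ofReal (by linarith),
    smul_eq_mul] at h1
  rw [besselKReal]
  linarith

theorem hasDerivAt_besselKReal_zero {x : ℝ} (hx : 0 < x) :
    HasDerivAt (besselKReal 0) (-besselKReal 1 x) x := by
  have h := hasDerivAt_besselKIntegral 0 hx
  have h1 : -(besselKIntegral (0 + 1) x + besselKIntegral (0 - 1) x) / 2
      = ((-besselKReal 1 x : ℝ) : ℂ) := by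
    rw [zero_add, zero_sub, besselKIntegral_neg, ← Complex.ofReal_one, besselKIntegral_ofReal]
    push_cast
    ring
  rw [h1] at h
  have h2 := Complex.reCLM.hasFDerivAt.comp_hasDerivAt x h
  simp only [Complex.reCLM_apply, Complex.ofReal_re] at h2
  refine h2.congr_of_eventuallyEq (Eventually.of_forall fun y => ?_)
  have := besselKIntegral_ofReal 0 y
  rw [Complex.ofReal_zero] at this
  simp [this]

/-- If `h = O(K_0 u)`, with `K_1 u` integrable, has a limit at `0`, then this limit is zero, since
`K_1 / K_0 = -(log K_0)'` is not integrable at `0`. -/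
theorem eq_zero_of_tendsto_of_integrableOn {h u : ℝ → ℂ} {c : ℂ}
    (hle : ∀ x, 0 < x → ‖h x‖ ≤ besselKReal 0 x * ‖u x‖)
    (hint : IntegrableOn (fun x => besselKReal 1 x * ‖u x‖) (Ioi 0))
    (hc : Tendsto h (𝓝[>] 0) (𝓝 c)) : c = 0 := by
  by_contra hne
  have hc0 : 0 < ‖c‖ := norm_pos_iff.2 hne
  have hder : ∀ x : ℝ, 0 < x → HasDerivAt (fun x => Real.log (besselKReal 0 x))
      (-besselKReal 1 x / besselKReal 0 x) x := fun x hx =>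
    (hasDerivAt_besselKReal_zero hx).log (besselKReal_pos 0 hx).ne'
  refine not_integrableOn_of_tendsto_norm_atTop_of_deriv_isBigO_filter
    (f := fun x => Real.log (besselKReal 0 x)) (𝓝[>] (0 : ℝ)) self_mem_nhdsWithin ?_ ?_ ?_ hint
  · filter_upwards [self_mem_nhdsWithin] with x hx using (hder x hx).differentiableAt
  · exact tendsto_norm_atTop_atTop.comp
      (Real.tendsto_log_atTop.comp tendsto_besselKReal_zero_atTop)
  · refine Asymptotics.IsBigO.of_bound (2 / ‖c‖) ?_
    filter_upwards [self_mem_nhdsWithin, hc.norm.eventually_const_lt (half_lt_self hc0)]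
      with x hx hlt
    have h0 := besselKReal_pos 0 hx
    have h1 := besselKReal_pos 1 hx
    rw [(hder x hx).deriv, norm_div, norm_neg, norm_mul, norm_norm, Real.norm_eq_abs,
      Real.norm_eq_abs, abs_of_pos h0, abs_of_pos h1, div_le_iff₀ h0]
    -- Near 0, |c|/2 < |h| ≤ K_0 |u|; multiplied by K_1 this bounds K_1/K_0 by a multiple of K_1
    -- |u|.
    have h2 : 1 ≤ 2 / ‖c‖ * (besselKReal 0 x * ‖u x‖) := by
      rw [div_mul_eq_mul_div, one_le_div hc0]
      linarith [hle x hx]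
    nlinarith [mul_le_mul_of_nonneg_left h2 h1.le]

/-- Integrability of h and h' forces h → 0 at infinity. At 0 it only provides a finite limit, which
`hzero` then makes zero. -/
theorem integral_Ioi_eq_zero_of_hasDerivAt {h h' : ℝ → ℂ}
    (hderiv : ∀ x ∈ Ioi (0 : ℝ), HasDerivAt h (h' x) x) (hh' : IntegrableOn h' (Ioi 0))
    (hh : IntegrableOn h (Ioi 0)) (hzero : ∀ c, Tendsto h (𝓝[>] 0) (𝓝 c) → c = 0) :
    ∫ x in Ioi (0 : ℝ), h' x = 0 := by
  have htop := tendsto_zero_of_hasDerivAt_of_integrableOn_Ioi hderiv hh' hh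
  have hcont : ContinuousOn (fun x : ℝ => ∫ t in x..1, h' t) (uIcc 0 1) := by
    refine intervalIntegral.continuousOn_primitive_interval_left ?_
    rw [uIcc_of_le zero_le_one, integrableOn_Icc_iff_integrableOn_Ioc]
    exact hh'.mono_set Ioc_subset_Ioi_self
  have hlim : Tendsto h (𝓝[>] 0) (𝓝 (h 1 - ∫ t in (0 : ℝ)..1, h' t)) := by
    have h0 : Tendsto (fun x : ℝ => ∫ t in x..1, h' t) (𝓝[>] 0) (𝓝 (∫ t in (0 : ℝ)..1, h' t)) := by
      refine (hcont 0 left_mem_uIcc).tendsto.mono_left ?_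
      rw [uIcc_of_le zero_le_one, ← nhdsWithin_Ioo_eq_nhdsGT (zero_lt_one' ℝ)]
      exact nhdsWithin_mono _ Ioo_subset_Icc_self
    refine (h0.const_sub (h 1)).congr' ?_
    filter_upwards [Ioo_mem_nhdsGT (zero_lt_one' ℝ)] with x hx
    rw [intervalIntegral.integral_eq_sub_of_hasDerivAt, sub_sub_cancel]
    · intro t ht
      rw [uIcc_of_le hx.2.le] at ht
      exact hderiv t (hx.1.trans_le ht.1)
    · rw [intervalIntegrable_iff_integrableOn_Ioc_of_le hx.2.le]
      exact hh'.mono_set fun t ht => hx.1.trans ht.1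
  have hlim0 : Tendsto h (𝓝[>] 0) (𝓝 0) := hzero _ hlim ▸ hlim
  -- The value of h at 0 is arbitrary; resetting it to 0 gives the continuity at the endpoint needed
  -- for the fundamental theorem.
  have hupd : ∀ x ∈ Ioi (0 : ℝ), Function.update h 0 0 =ᶠ[𝓝 x] h := fun x hx => by
    filter_upwards [Ioi_mem_nhds hx] with y hy
    exact Function.update_of_ne (ne_of_gt hy) _ _
  have key := integral_Ioi_of_hasDerivAt_of_tendsto (f := Function.update h 0 0) (f' := h')
    (a := 0) (m := 0) ?_ (fun x hx => (hderiv x hx).congr_of_eventuallyEq (hupd x hx)) hh' ?_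
  · simpa using key
  · rw [continuousWithinAt_update_same, Ici_sdiff_left]
    exact hlim0
  · refine htop.congr' ?_
    filter_upwards [Ioi_mem_atTop 0] with y hy
    exact (Function.update_of_ne (ne_of_gt hy) _ _).symm

/-! ### The Kontorovich–Lebedev transform -/

theorem klIntegrand_eq (g : ℝ → ℂ) (s : ℂ) {x : ℝ} (hx : 0 < x) :
    klIntegrand g s x = besselKIntegral (Complex.I * s) x * g x / x := by
  rw [klIntegrand, macdonaldK_eq _ hx]

theorem norm_klIntegrand_le (g : ℝ → ℂ) (s : ℂ) {x : ℝ} (hx : 0 < x) :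
    ‖klIntegrand g s x‖ ≤ besselKReal s.im x * ‖g x / x‖ := by
  rw [klIntegrand_eq g s hx, mul_div_assoc, norm_mul]
  have h := norm_besselKIntegral_le (Complex.I * s) x
  rw [Complex.I_mul_re, besselKReal_neg] at h
  exact mul_le_mul_of_nonneg_right h (norm_nonneg _)

theorem norm_klIntegrand_I (g : ℝ → ℂ) {x : ℝ} (hx : 0 < x) :
    ‖klIntegrand g Complex.I x‖ = besselKReal 1 x * ‖g x / x‖ := by
  rw [klIntegrand_eq g _ hx, mul_div_assoc, norm_mul, Complex.I_mul_I, besselKIntegral_neg,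
    ← Complex.ofReal_one, besselKIntegral_ofReal, Complex.norm_real, Real.norm_eq_abs,
    abs_of_pos (besselKReal_pos 1 hx)]

/-- A single majorant for the closed strip, integrable by convergence at s = i, where the kernel is
K_{−1} = K_1 > 0. -/
theorem norm_klIntegrand_le_of_abs_im_le (g : ℝ → ℂ) {s : ℂ} (hs : |s.im| ≤ 1) {x : ℝ}
    (hx : 0 < x) : ‖klIntegrand g s x‖ ≤ 2 * ‖klIntegrand g Complex.I x‖ := by
  refine (norm_klIntegrand_le g s hx).trans ?_
  rw [norm_klIntegrand_I g hx, ← mul_assoc]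
  exact mul_le_mul_of_nonneg_right (besselKReal_le hs hx) (norm_nonneg _)

theorem differentiable_klIntegrand (g : ℝ → ℂ) {x : ℝ} (hx : 0 < x) :
    Differentiable ℂ fun s => klIntegrand g s x := by
  simp only [klIntegrand_eq g _ hx]
  exact (((differentiable_besselKIntegral hx).comp
    (differentiable_id.const_mul Complex.I)).mul_const _).div_const _

theorem diffContOnCl_klTransform {g : ℝ → ℂ} (hconv : ∀ s : ℂ, |s.im| ≤ 1 → KLConverges g s) :
    DiffContOnCl ℂ (klTransform g) {s : ℂ | |s.im| < 1} := by
  have hbound : Integrable (fun x => 2 * ‖klIntegrand g Complex.I x‖)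
      (volume.restrict (Ioi 0)) := (hconv Complex.I (by simp)).norm.const_mul 2
  have hcont : Continuous fun s : ℂ => |s.im| := Complex.continuous_im.abs
  constructor
  · refine differentiableOn_integral_of_dominated (isOpen_lt hcont continuous_const)
      (fun s hs => (hconv s (le_of_lt hs)).aestronglyMeasurable) ?_ ?_ hbound
    · filter_upwards [ae_restrict_mem measurableSet_Ioi] with x hx
      exact (differentiable_klIntegrand g hx).differentiableOn
    · filter_upwards [ae_restrict_mem measurableSet_Ioi] with x hx s hs
      exact norm_klIntegrand_le_of_abs_im_le g (le_of_lt hs) hx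
  · have hsub : closure {s : ℂ | |s.im| < 1} ⊆ {s : ℂ | |s.im| ≤ 1} :=
      closure_minimal (fun s (hs : |s.im| < 1) => hs.le) (isClosed_le hcont continuous_const)
    refine ContinuousOn.mono ?_ hsub
    refine continuousOn_of_dominated (fun s hs => (hconv s hs).aestronglyMeasurable)
      (fun s hs => ?_) hbound ?_
    · filter_upwards [ae_restrict_mem measurableSet_Ioi] with x hx
      exact norm_klIntegrand_le_of_abs_im_le g hs hx
    · filter_upwards [ae_restrict_mem measurableSet_Ioi] with x hx
      exact (differentiable_klIntegrand g hx).continuous.continuousOn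

/-- Since i(s ± i) = is ∓ 1, the formula for K_ν' produces the two shifts. The term −1/x of Q comes
from differentiating the factor 1/x of the measure. -/
theorem hasDerivAt_klIntegrand {g : ℝ → ℂ} (s : ℂ) {x : ℝ} (hx : 0 < x)
    (hg : DifferentiableAt ℝ g x) :
    HasDerivAt (klIntegrand g s) (klIntegrand (opQ g) s x
      - (klIntegrand g (s + Complex.I) x + klIntegrand g (s - Complex.I) x) / 2) x := by
  have hx' : (x : ℂ) ≠ 0 := by exact_mod_cast hx.ne'
  have hd := ((hasDerivAt_besselKIntegral (Complex.I * s) hx).mul hg.hasDerivAt).div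
    ((hasDerivAt_id x).ofReal_comp) hx'
  refine HasDerivAt.congr_of_eventuallyEq (hd.congr_deriv ?_)
    (Filter.eventually_of_mem (Ioi_mem_nhds hx) fun y hy => klIntegrand_eq g s hy)
  simp only [klIntegrand_eq _ _ hx, opQ, mul_add, mul_sub, Complex.I_mul_I, sub_neg_eq_add,
    ← sub_eq_add_neg, Pi.mul_apply, id_eq, Complex.ofReal_one]
  field_simp
  ring

theorem klTransform_opQ {g : ℝ → ℂ} (hg : DifferentiableOn ℝ g (Ioi 0))
    (hconv : ∀ s : ℂ, |s.im| ≤ 1 → KLConverges g s)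
    (s : ℝ) (hconvQ : KLConverges (opQ g) s) :
    klTransform (opQ g) s = opM (klTransform g) s := by
  have hp : IntegrableOn (klIntegrand g (s + Complex.I)) (Ioi 0) := hconv _ (by simp)
  have hm : IntegrableOn (klIntegrand g (s - Complex.I)) (Ioi 0) := hconv _ (by simp)
  have hpm : IntegrableOn (fun x => (klIntegrand g (s + Complex.I) x
      + klIntegrand g (s - Complex.I) x) / 2) (Ioi 0) := (hp.add hm).div_const 2
  have hQ : IntegrableOn (klIntegrand (opQ g) s) (Ioi 0) := hconvQ
  -- For real s the order is is purely imaginary, so the kernel is bounded by K_0.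
  have hzero : ∀ c, Tendsto (klIntegrand g s) (𝓝[>] 0) (𝓝 c) → c = 0 := fun c hc => by
    refine eq_zero_of_tendsto_of_integrableOn (u := fun x => g x / x)
      (fun x hx => by simpa using norm_klIntegrand_le g s hx) ?_ hc
    refine IntegrableOn.congr_fun (hconv Complex.I (by simp)).norm (fun x hx => ?_)
      measurableSet_Ioi
    exact norm_klIntegrand_I g hx
  have key := integral_Ioi_eq_zero_of_hasDerivAt
    (fun x hx => hasDerivAt_klIntegrand s hx (hg.differentiableAt (Ioi_mem_nhds hx)))
    (hQ.sub hpm) (hconv s (by simp)) hzero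
  rw [integral_sub hQ hpm, integral_div, integral_add hp hm, sub_eq_zero] at key
  exact key

end KontorovichLebedev

/-- The Kontorovich–Lebedev transform sends `Q` to `𝓜`. The transform `f` of `g` is holomorphic in
the strip `|Im s| < 1` and continuous up to its boundary, so that `f(s + i)` and `f(s - i)` are the
values of the continuation of `f` from the real line. -/
theorem mainTheorem11 (g : ℝ → ℂ)
    (hg : DifferentiableOn ℝ g (Set.Ioi 0))
    (hconv : ∀ s : ℂ, |s.im| ≤ 1 → KontorovichLebedev.KLConverges g s)
    (hconvQ : ∀ s : ℝ, KontorovichLebedev.KLConverges (KontorovichLebedev.opQ g) (s : ℂ)) :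
    DiffContOnCl ℂ (KontorovichLebedev.klTransform g) {s : ℂ | |s.im| < 1} ∧
    ∀ s : ℝ, KontorovichLebedev.klTransform (KontorovichLebedev.opQ g) (s : ℂ) =
      KontorovichLebedev.opM (KontorovichLebedev.klTransform g) (s : ℂ) :=
  ⟨KontorovichLebedev.diffContOnCl_klTransform hconv,
    fun s => KontorovichLebedev.klTransform_opQ hg hconv s (hconvQ s)⟩
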